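/- Let $\mathbf X^3$ be the sphere $\mathbf S^3$, Euclidean space $\mathbf E^3$ or hyperbolic space $\mathbf H^3$, and let $\mathfrak t$ be a nondegenerate tetrahedron of finite volume in $\mathbf X^3$ (in the hyperbolic case some or all of its vertices may be ideal) that is a Coxeter tetrahedron, i.e. each of its six dihedral angles is $\pi/k$ for some integer $k\ge 2$ (depending on the edge). Let $P,Q,R,S$ be the reflections of $\mathbf X^3$ in the four faces of $\mathfrak t$, let $H=\langle P,Q,R,S\rangle$, let $M$ be a subgroup of $H$, and let $\mathcal O=\{m\mathfrak t : m\in M\}$ be the $M$-orbit of $\mathfrak t$, where $m\mathfrak t$ is the image of $\mathfrak t$ under $m$. For a positive integer $n$, an $n$-coloring of $\mathcal O$ is a surjection $f:\mathcal O\to C$ onto a set $C$ of $n$ colors. It is called $M$-transitive if the rule "$mc=c'$ if and only if $m f^{-1}(c)=f^{-1}(c')$", for $m\in M$ and $c,c'\in C$, defines an action of $M$ on $C$ and this action is transitive; $m$ is said to fix the color $c$ if $mc=c$, i.e. $m f^{-1}(c)=f^{-1}(c)$. **Theorem.** (i) Let $L$ be a subgroup of $M$ of finite index $n$, let $\{m_1,\dots,m_n\}$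 be a complete set of left coset representatives of $L$ in $M$, and let $C=\{c_1,\dots,c_n\}$ be a set of $n$ colors. Then assigning the color $c_i$ to every element of $m_iL\mathfrak t=\{m_il\,\mathfrak t : l\in L\}$, $i=1,\dots,n$, gives a well-defined function $f:\mathcal O\to C$; it satisfies $f^{-1}(c_i)=m_iL\mathfrak t$ for all $i$, and it is an $M$-transitive $n$-coloring of $\mathcal O$. (ii) Conversely, in any $M$-transitive $n$-coloring of $\mathcal O$ and for any color $c$, the elements of $M$ that fix $c$ form a subgroup of $M$ of index $n$. -/

import Mathlib

open scoped Pointwise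

namespace TetrahedronColoring

/-- The three geometries of constant curvature in dimension three: `S³`, `E³` and `H³`. -/
inductive Geometry
  | spherical
  | euclidean
  | hyperbolic

/-- The sectional curvature: `1` for `S³`, `0` for `E³`, `-1` for `H³`. -/
def Geometry.curvature : Geometry → ℝ
  | spherical => 1
  | euclidean => 0
  | hyperbolic => -1

/-- The symmetric bilinear form `κ x₀ y₀ + x₁ y₁ + x₂ y₂ + x₃ y₃` on `ℝ⁴`, where `κ` is the
curvature: the Euclidean inner product of `ℝ⁴` for `S³`, the Euclidean inner product of the last
three coordinates for `E³`, and the Lorentzian inner product for `H³`. -/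
def form (g : Geometry) (x y : Fin 4 → ℝ) : ℝ :=
  g.curvature * (x 0 * y 0) + x 1 * y 1 + x 2 * y 2 + x 3 * y 3

/-- The points of the three spaces in `ℝ⁴`: the unit sphere `S³`, the affine hyperplane `x₀ = 1`
as a copy of Euclidean space `E³`, and the upper sheet of the hyperboloid as `H³`. -/
def IsPoint : Geometry → (Fin 4 → ℝ) → Prop
  | .spherical, x => form .spherical x x = 1
  | .euclidean, x => x 0 = 1
  | .hyperbolic, x => form .hyperbolic x x = -1 ∧ 0 < x 0

/-- The space `X³`, equal to `S³`, `E³` or `H³`. -/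
def Space (g : Geometry) : Type := {x : Fin 4 → ℝ // IsPoint g x}

/-- What is allowed as a vertex of a tetrahedron of finite volume: a point of the space or, in the
hyperbolic case, also an ideal point, given by a vector that spans its ray in the future light
cone. -/
def IsVertex : Geometry → (Fin 4 → ℝ) → Prop
  | .spherical, x => IsPoint .spherical x
  | .euclidean, x => IsPoint .euclidean x
  | .hyperbolic, x => IsPoint .hyperbolic x ∨ (form .hyperbolic x x = 0 ∧ 0 < x 0)

/-- A plane of `X³` is the set of all `x` in `X³` with `n₀ x₀ + n₁ x₁ + n₂ x₂ + n₃ x₃ = 0`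
(that is, `n ⬝ᵥ x = 0`) for some `n` in `ℝ⁴` with `form g n n = 1`. This is the unit normal vector
of that plane, pointing to the side `0 < n ⬝ᵥ x`. One has `n ⬝ᵥ x = form g (normalVector g n) x` in
the spherical and the hyperbolic case. In the Euclidean case the plane is
`n₀ + ⟨(n₁, n₂, n₃), y⟩ = 0`, with unit normal `(n₁, n₂, n₃)`. -/
def normalVector (g : Geometry) (n : Fin 4 → ℝ) : Fin 4 → ℝ :=
  ![g.curvature * n 0, n 1, n 2, n 3]

/-- The formula for the reflection of `X³` in the plane `n ⬝ᵥ x = 0`, where `form g n n = 1`. -/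
def reflect (g : Geometry) (n x : Fin 4 → ℝ) : Fin 4 → ℝ :=
  x - (2 * (n ⬝ᵥ x)) • normalVector g n

theorem reflect_reflect (g : Geometry) (n x : Fin 4 → ℝ) (hn : form g n n = 1) :
    reflect g n (reflect g n x) = x := by
  have h : n ⬝ᵥ normalVector g n = 1 := by
    rw [← hn]
    simp [dotProduct, Fin.sum_univ_four, normalVector, form]
    ring
  have h2 : n ⬝ᵥ reflect g n x = -(n ⬝ᵥ x) := by
    rw [reflect, dotProduct_sub, dotProduct_smul, h, smul_eq_mul]
    ring
  rw [reflect, h2, reflect]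
  ext i
  simp

theorem isPoint_reflect (g : Geometry) (n x : Fin 4 → ℝ) (hn : form g n n = 1)
    (hx : IsPoint g x) : IsPoint g (reflect g n x) := by
  cases g with
  | spherical =>
    simp only [IsPoint, form, Geometry.curvature, reflect, normalVector, dotProduct,
      Fin.sum_univ_four, Pi.sub_apply, Pi.smul_apply, smul_eq_mul, Matrix.cons_val] at *
    linear_combination hx + 4 * (n 0 * x 0 + n 1 * x 1 + n 2 * x 2 + n 3 * x 3) ^ 2 * hn
  | euclidean =>
    simpa [IsPoint, Geometry.curvature, reflect, normalVector] using hx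
  | hyperbolic =>
    simp only [IsPoint, form, Geometry.curvature] at hx hn ⊢
    obtain ⟨hx1, hx0⟩ := hx
    set d := n ⬝ᵥ x with hd
    have e0 : reflect .hyperbolic n x 0 = x 0 + 2 * d * n 0 := by
      simp [reflect, normalVector, Geometry.curvature, hd]
    have e1 : reflect .hyperbolic n x 1 = x 1 - 2 * d * n 1 := by
      simp [reflect, normalVector, hd]
    have e2 : reflect .hyperbolic n x 2 = x 2 - 2 * d * n 2 := by
      simp [reflect, normalVector, hd]
    have e3 : reflect .hyperbolic n x 3 = x 3 - 2 * d * n 3 := by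
      simp [reflect, normalVector, hd]
    have hd' : d = n 0 * x 0 + n 1 * x 1 + n 2 * x 2 + n 3 * x 3 := by
      simp [hd, dotProduct, Fin.sum_univ_four]
    generalize reflect .hyperbolic n x 0 = y0 at *
    generalize reflect .hyperbolic n x 1 = y1 at *
    generalize reflect .hyperbolic n x 2 = y2 at *
    generalize reflect .hyperbolic n x 3 = y3 at *
    have key : -1 * (y0 * y0) + y1 * y1 + y2 * y2 + y3 * y3 = -1 := by
      subst e0 e1 e2 e3
      linear_combination hx1 + 4 * d ^ 2 * hn + 4 * d * hd'
    have key2 : -(x 0 * y0) + (x 1 * y1 + x 2 * y2 + x 3 * y3) = -1 - 2 * d ^ 2 := by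
      subst e0 e1 e2 e3
      linear_combination hx1 + 2 * d * hd'
    refine ⟨key, ?_⟩
    by_contra hneg
    have hle : x 0 * y0 ≤ 0 := mul_nonpos_of_nonneg_of_nonpos hx0.le (not_lt.mp hneg)
    have hlt : x 1 * y1 + x 2 * y2 + x 3 * y3 < x 0 * y0 := by nlinarith [sq_nonneg d]
    have hsq : (x 0 * y0) ^ 2 < (x 1 * y1 + x 2 * y2 + x 3 * y3) ^ 2 := by nlinarith
    have hcs : (x 1 * y1 + x 2 * y2 + x 3 * y3) ^ 2 ≤
        (x 1 ^ 2 + x 2 ^ 2 + x 3 ^ 2) * (y1 ^ 2 + y2 ^ 2 + y3 ^ 2) := by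
      nlinarith [sq_nonneg (x 1 * y2 - x 2 * y1), sq_nonneg (x 1 * y3 - x 3 * y1),
        sq_nonneg (x 2 * y3 - x 3 * y2)]
    have ha : x 1 ^ 2 + x 2 ^ 2 + x 3 ^ 2 = x 0 ^ 2 - 1 := by linear_combination hx1
    have hb : y1 ^ 2 + y2 ^ 2 + y3 ^ 2 = y0 ^ 2 - 1 := by linear_combination key
    rw [ha, hb] at hcs
    nlinarith [sq_nonneg (x 1), sq_nonneg (x 2), sq_nonneg (x 3), sq_nonneg y1, sq_nonneg y2,
      sq_nonneg y3]

/-- The reflection of `X³` in the plane `n ⬝ᵥ x = 0`, as a permutation of `X³`. -/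
def planeReflection (g : Geometry) (n : Fin 4 → ℝ) (hn : form g n n = 1) :
    Equiv.Perm (Space g) :=
  Function.Involutive.toPerm
    (fun x : Space g => (⟨reflect g n x.1, isPoint_reflect g n x.1 hn x.2⟩ : Space g))
    (fun x => Subtype.ext (reflect_reflect g n x.1 hn))

/-- A (nondegenerate) tetrahedron of finite volume in `X³`, given by its vertices `P₀, P₁, P₂, P₃`;
in the hyperbolic case some or all vertices may be ideal. -/
structure Tetrahedron (g : Geometry) where
  vertex : Fin 4 → Fin 4 → ℝ
  isVertex : ∀ i, IsVertex g (vertex i)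
  linearIndependent : LinearIndependent ℝ vertex

namespace Tetrahedron

variable {g : Geometry} (t : Tetrahedron g)

/-- The tetrahedron as a subset of `X³`: the points of `X³` in the convex cone spanned by the
vertices. (In `E³` the coefficients add up to `1`, so that it is the convex hull.) -/
def body : Set (Space g) :=
  {x | ∃ a : Fin 4 → ℝ, (∀ i, 0 ≤ a i) ∧ x.1 = ∑ i, a i • t.vertex i}

/-- `n` is the inward unit normal of the face opposite to the vertex `Pᵢ`: the plane `n ⬝ᵥ x = 0`
contains the other three vertices, and `Pᵢ` lies on its positive side. -/
def IsFaceNormal (i : Fin 4) (n : Fin 4 → ℝ) : Prop :=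
  form g n n = 1 ∧ (∀ j, j ≠ i → n ⬝ᵥ t.vertex j = 0) ∧ 0 < n ⬝ᵥ t.vertex i

theorem form_pos_of_dotProduct_eq_zero (i : Fin 4) (l : Fin 4 → ℝ) (hl : l ≠ 0)
    (h : ∀ j, j ≠ i → l ⬝ᵥ t.vertex j = 0) : 0 < form g l l := by
  have hne : l 0 ≠ 0 ∨ l 1 ≠ 0 ∨ l 2 ≠ 0 ∨ l 3 ≠ 0 := by
    by_contra! hc
    obtain ⟨h0, h1, h2, h3⟩ := hc
    exact hl (by ext k; fin_cases k <;> simp [*])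
  obtain ⟨j, k, hji, hki, hjk⟩ : ∃ j k : Fin 4, j ≠ i ∧ k ≠ i ∧ j ≠ k := by
    fin_cases i
    exacts [⟨1, 2, by decide⟩, ⟨0, 2, by decide⟩, ⟨0, 1, by decide⟩, ⟨0, 1, by decide⟩]
  have hj := h j hji
  have hk := h k hki
  have vj := t.isVertex j
  have vk := t.isVertex k
  have hli := t.linearIndependent
  cases g with
  | spherical =>
    simp only [form, Geometry.curvature]
    rcases hne with h | h | h | h <;>
      nlinarith [mul_self_pos.mpr h, mul_self_nonneg (l 0), mul_self_nonneg (l 1),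
        mul_self_nonneg (l 2), mul_self_nonneg (l 3)]
  | euclidean =>
    simp only [form, Geometry.curvature]
    have hne' : l 1 ≠ 0 ∨ l 2 ≠ 0 ∨ l 3 ≠ 0 := by
      by_contra! hc
      obtain ⟨h1, h2, h3⟩ := hc
      simp only [IsVertex, IsPoint] at vj
      simp [dotProduct, Fin.sum_univ_four, h1, h2, h3, vj] at hj
      simp_all
    rcases hne' with h | h | h <;>
      nlinarith [mul_self_pos.mpr h, mul_self_nonneg (l 1), mul_self_nonneg (l 2),
        mul_self_nonneg (l 3)]
  | hyperbolic =>
    have caus : ∀ x, IsVertex .hyperbolic x → 0 < x 0 ∧ x 1 ^ 2 + x 2 ^ 2 + x 3 ^ 2 ≤ x 0 ^ 2 := by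
      rintro x (⟨h1, h2⟩ | ⟨h1, h2⟩) <;> simp only [form, Geometry.curvature] at h1 <;>
        exact ⟨h2, by nlinarith⟩
    obtain ⟨xp, xc⟩ := caus _ vj
    obtain ⟨yp, yc⟩ := caus _ vk
    set x := t.vertex j with hx
    set y := t.vertex k with hy
    have hnp : ¬ (x 0 * y 1 = y 0 * x 1 ∧ x 0 * y 2 = y 0 * x 2 ∧ x 0 * y 3 = y 0 * x 3) := by
      rintro ⟨e1, e2, e3⟩
      have hpair : LinearIndependent ℝ ![x, y] := by
        have := hli.comp ![j, k] (by
          intro a b hab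
          fin_cases a <;> fin_cases b <;> simp_all [eq_comm])
        convert this using 1
        ext a b
        fin_cases a <;> simp [hx, hy]
      have := LinearIndependent.pair_iff.mp hpair (-(y 0)) (x 0) (by
        ext b
        fin_cases b <;> simp <;> linarith)
      exact xp.ne' this.2
    simp only [form, Geometry.curvature]
    simp only [dotProduct, Fin.sum_univ_four] at hj hk
    generalize x 0 = x0 at *
    generalize x 1 = x1 at *
    generalize x 2 = x2 at *
    generalize x 3 = x3 at *
    generalize y 0 = y0 at *
    generalize y 1 = y1 at *
    generalize y 2 = y2 at *
    generalize y 3 = y3 at *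
    generalize l 0 = l0 at *
    generalize l 1 = l1 at *
    generalize l 2 = l2 at *
    generalize l 3 = l3 at *
    clear_value x y
    -- the midpoint direction is timelike
    have time : (y0 * x1 + x0 * y1) ^ 2 + (y0 * x2 + x0 * y2) ^ 2 + (y0 * x3 + x0 * y3) ^ 2 <
        (2 * x0 * y0) ^ 2 := by
      have hd : 0 < (x0 * y1 - y0 * x1) ^ 2 + (x0 * y2 - y0 * x2) ^ 2 +
          (x0 * y3 - y0 * x3) ^ 2 := by
        by_contra hc
        apply hnp
        have q1 := sq_nonneg (x0 * y1 - y0 * x1)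
        have q2 := sq_nonneg (x0 * y2 - y0 * x2)
        have q3 := sq_nonneg (x0 * y3 - y0 * x3)
        refine ⟨?_, ?_, ?_⟩ <;> apply sub_eq_zero.mp <;> apply pow_eq_zero_iff two_ne_zero |>.mp <;>
          linarith
      have a1 := mul_le_mul_of_nonneg_left xc (sq_nonneg y0)
      have a2 := mul_le_mul_of_nonneg_left yc (sq_nonneg x0)
      nlinarith
    have orth : l0 * (2 * x0 * y0) + l1 * (y0 * x1 + x0 * y1) + l2 * (y0 * x2 + x0 * y2) +
        l3 * (y0 * x3 + x0 * y3) = 0 := by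
      linear_combination y0 * hj + x0 * hk
    have sp : 0 < 2 * x0 * y0 := by positivity
    generalize 2 * x0 * y0 = s0 at *
    generalize y0 * x1 + x0 * y1 = s1 at *
    generalize y0 * x2 + x0 * y2 = s2 at *
    generalize y0 * x3 + x0 * y3 = s3 at *
    have hl' : 0 < l1 ^ 2 + l2 ^ 2 + l3 ^ 2 := by
      by_contra hc
      have q1 := sq_nonneg l1
      have q2 := sq_nonneg l2
      have q3 := sq_nonneg l3
      have r1 : l1 = 0 := pow_eq_zero_iff two_ne_zero |>.mp (by linarith)
      have r2 : l2 = 0 := pow_eq_zero_iff two_ne_zero |>.mp (by linarith)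
      have r3 : l3 = 0 := pow_eq_zero_iff two_ne_zero |>.mp (by linarith)
      subst r1 r2 r3
      have : l0 * s0 = 0 := by linarith
      simp [sp.ne'] at this
      simp_all
    have hcs : (l1 * s1 + l2 * s2 + l3 * s3) ^ 2 ≤
        (l1 ^ 2 + l2 ^ 2 + l3 ^ 2) * (s1 ^ 2 + s2 ^ 2 + s3 ^ 2) := by
      nlinarith [sq_nonneg (l1 * s2 - l2 * s1), sq_nonneg (l1 * s3 - l3 * s1),
        sq_nonneg (l2 * s3 - l3 * s2)]
    have hm := mul_lt_mul_of_pos_left time hl'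
    have e : (l1 * s1 + l2 * s2 + l3 * s3) ^ 2 = l0 ^ 2 * s0 ^ 2 := by
      have : l1 * s1 + l2 * s2 + l3 * s3 = -(l0 * s0) := by linarith
      rw [this]; ring
    have hfin : l0 ^ 2 * s0 ^ 2 < (l1 ^ 2 + l2 ^ 2 + l3 ^ 2) * s0 ^ 2 := by linarith
    have := lt_of_mul_lt_mul_right hfin (sq_nonneg s0)
    nlinarith

theorem form_smul (g : Geometry) (a : ℝ) (l : Fin 4 → ℝ) :
    form g (a • l) (a • l) = a ^ 2 * form g l l := by
  simp [form]
  ring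

theorem existsUnique_isFaceNormal (i : Fin 4) : ∃! n, t.IsFaceNormal i n := by
  let b := basisOfLinearIndependentOfCardEqFinrank t.linearIndependent (by simp)
  have hb : ∀ j, b j = t.vertex j := fun j => by simp [b]
  let l : Fin 4 → ℝ := fun k => b.coord i (Pi.single k 1)
  have hlx : ∀ x : Fin 4 → ℝ, l ⬝ᵥ x = b.coord i x := by
    intro x
    conv_rhs => rw [pi_eq_sum_univ' x]
    simp [l, dotProduct, mul_comm]
  have hl1 : l ⬝ᵥ t.vertex i = 1 := by rw [hlx, ← hb]; simp
  have hl0 : ∀ j, j ≠ i → l ⬝ᵥ t.vertex j = 0 := by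
    intro j hj
    rw [hlx, ← hb]
    simp [hj]
  have hlne : l ≠ 0 := by
    intro h
    simp [h] at hl1
  have hpos := t.form_pos_of_dotProduct_eq_zero i l hlne hl0
  have hs := Real.sqrt_pos.mpr hpos
  refine ⟨(Real.sqrt (form g l l))⁻¹ • l, ⟨?_, ?_, ?_⟩, ?_⟩
  · rw [form_smul, inv_pow, Real.sq_sqrt hpos.le, inv_mul_cancel₀ hpos.ne']
  · intro j hj
    rw [smul_dotProduct, hl0 j hj, smul_zero]
  · rw [smul_dotProduct, hl1]
    simpa using hpos
  · rintro n ⟨h1, h2, h3⟩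
    set c := n ⬝ᵥ t.vertex i with hc
    have hn : n = c • l := by
      refine dotProduct_eq _ _ fun u => ?_
      rw [smul_dotProduct, hlx, smul_eq_mul, Module.Basis.coord_apply]
      conv_lhs => rw [← b.sum_repr u]
      rw [dotProduct_sum, Finset.sum_eq_single i]
      · rw [dotProduct_smul, hb, smul_eq_mul, mul_comm]
      · intro j _ hj
        rw [dotProduct_smul, hb, h2 j hj, smul_zero]
      · simp
    have hc2 : c ^ 2 * form g l l = 1 := by rw [← form_smul, ← hn, h1]
    have hc3 : c = (Real.sqrt (form g l l))⁻¹ := by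
      rw [← Real.sqrt_inv, eq_comm, Real.sqrt_eq_iff_mul_self_eq_of_pos h3]
      field_simp
      linarith
    rw [← hc3]
    exact hn

/-- The inward unit normal of the face opposite to the vertex `Pᵢ`. -/
noncomputable def faceNormal (i : Fin 4) : Fin 4 → ℝ :=
  (t.existsUnique_isFaceNormal i).choose

theorem isFaceNormal_faceNormal (i : Fin 4) : t.IsFaceNormal i (t.faceNormal i) :=
  (t.existsUnique_isFaceNormal i).choose_spec.1

/-- The reflection in the face opposite to the vertex `Pᵢ`. -/
noncomputable def faceReflection (i : Fin 4) : Equiv.Perm (Space g) :=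
  planeReflection g (t.faceNormal i) (t.isFaceNormal_faceNormal i).1

/-- The dihedral angle between the faces opposite to `Pᵢ` and `Pⱼ`, for `i ≠ j`: it is `π` minus the
angle between the inward unit normals. -/
noncomputable def dihedralAngle (i j : Fin 4) : ℝ :=
  Real.arccos (-form g (t.faceNormal i) (t.faceNormal j))

/-- A Coxeter tetrahedron: all six dihedral angles are submultiples of `π`. -/
def IsCoxeter : Prop :=
  ∀ i j, i ≠ j → ∃ m : ℕ, 2 ≤ m ∧ t.dihedralAngle i j = Real.pi / m

/-- The tetrahedron group `H = ⟨P, Q, R, S⟩` generated by the reflections in the four faces. -/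
noncomputable def tetrahedronGroup : Subgroup (Equiv.Perm (Space g)) :=
  Subgroup.closure
    {t.faceReflection 0, t.faceReflection 1, t.faceReflection 2, t.faceReflection 3}

/-- The orbit `𝒪 = {m t : m ∈ M}` of the tetrahedron under a subgroup `M` of its group. Elements of
`M` act on subsets of `X³` by taking images. -/
abbrev Orbit (M : Subgroup t.tetrahedronGroup) : Type :=
  MulAction.orbit M t.body

/-- The set `m L t = {m l t : l ∈ L}` of tetrahedra in the orbit `𝒪 = M t`. -/
def cosetTiles {M : Subgroup t.tetrahedronGroup} (L : Subgroup M) (m : M) : Set (t.Orbit M) :=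
  {x | ∃ l ∈ L, x.1 = (m * l) • t.body}

/-- `f` is an `M`-transitive `n`-coloring of the orbit `𝒪 = M t`: there are `n` colors, `f` is onto,
and `M` acts transitively on the set of colors by `m c = c'` if and only if
`m f⁻¹(c) = f⁻¹(c')`. -/
def IsTransitiveColoring (M : Subgroup t.tetrahedronGroup) (n : ℕ) {C : Type*} [Finite C]
    (f : t.Orbit M → C) : Prop :=
  Nat.card C = n ∧ Function.Surjective f ∧
    ∃ _ : MulAction M C,
      (∀ (m : M) (c c' : C), m • c = c' ↔ m • (f ⁻¹' {c}) = f ⁻¹' {c'}) ∧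
      MulAction.IsPretransitive M C

end Tetrahedron

end TetrahedronColoring

/-! Everything rests on one fact: only the identity of $H$ maps $\mathfrak t$ to itself. Then $m
\mapsto m\mathfrak t$ is an equivariant bijection from $M$ to $\mathcal O$, the sets $m_iL\mathfrak
t$ correspond to the left cosets of $L$, and (i) is the action of $M$ on $M/L$. Part (ii) is the
orbit–stabilizer theorem.

For the fact, let the abstract Coxeter group $W$ of the dihedral angles act on linear forms, its
generators acting as reflections in the inward face normals $\alpha_i$. Each $h \in H$ is dual to
some $w \in W$: the form $w\ell$ takes at $hx$ the value of $\ell$ at $x$. If $h\mathfrak t =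
\mathfrak t$ and $w \ne 1$, choose $i$ with $\ell(ws_i) < \ell(w)$. Tits' positivity theorem
(`apply_mem_of_not_isRightDescent`) makes $w\alpha_i = -ws_i\alpha_i$ nonpositive on $\mathfrak t$,
while invariance of $\mathfrak t$ makes it nonnegative there. So $w\alpha_i$ vanishes on $\mathfrak
t$, hence is zero, which is absurd. Thus $w = 1$ and $h = 1$. -/

namespace Real

/-! ### Sines occurring as root coefficients in dihedral groups. -/

theorem sin_pi_div_pos {m : ℕ} (hm : 2 ≤ m) : 0 < sin (π / m) := by
  have hm' : (1 : ℝ) < m := by exact_mod_cast hm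
  exact sin_pos_of_pos_of_lt_pi (by positivity) (div_lt_self pi_pos hm')

theorem sin_mul_pi_div_nonneg {k m : ℕ} (hk : k ≤ m) : 0 ≤ sin (k * (π / m)) := by
  rcases Nat.eq_zero_or_pos m with rfl | hm
  · simp
  have hm' : (0 : ℝ) < m := by exact_mod_cast hm
  have hk' : (k : ℝ) ≤ m := by exact_mod_cast hk
  refine sin_nonneg_of_nonneg_of_le_pi (by positivity) ?_
  rw [mul_div_assoc', div_le_iff₀ hm', mul_comm]
  gcongr

theorem sin_add_two_mul (k θ : ℝ) :
    sin ((k + 1 + 1) * θ) =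
      2 * cos θ * sin ((k + 1) * θ) - sin (k * θ) := by
  have h1 : (k + 1 + 1) * θ = (k + 1) * θ + θ := by ring
  have h2 : k * θ = (k + 1) * θ - θ := by ring
  rw [h1, h2, sin_add, sin_sub]
  ring

end Real

/-! ### Coxeter groups: reduction to rank two and positivity of roots. -/

namespace CoxeterSystem

variable {B W V : Type*} [Group W] {M : CoxeterMatrix B} [AddCommGroup V] [Module ℝ V]

/-- An element `w` without right descent `i` is `v u` with `u` an alternating word in `i, j` ending
with `j`, lengths adding up, and `v` of minimal length in its coset of `⟨sᵢ, sⱼ⟩`. -/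
theorem exists_eq_mul_alternatingWord (cs : CoxeterSystem M W) {w : W} {i : B} (j : B)
    (hi : ¬ cs.IsRightDescent w i) :
    ∃ (v : W) (k : ℕ), w = v * cs.wordProd (alternatingWord i j k) ∧
      cs.length w = cs.length v + k ∧ ¬ cs.IsRightDescent v i ∧ ¬ cs.IsRightDescent v j := by
  induction hn : cs.length w generalizing w i j with
  | zero =>
    refine ⟨w, 0, by simp [alternatingWord], by simp [hn], hi, ?_⟩
    simp [IsRightDescent, hn]
  | succ n ih =>
    by_cases hj : cs.IsRightDescent w j
    · have hlen := cs.isRightDescent_iff.mp hj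
      -- Strip the final `j` from `w`; the shorter element has no right descent `j`, so the
      -- induction hypothesis applies with `i` and `j` exchanged.
      obtain ⟨v, k, hw, hl, hvj, hvi⟩ :=
        ih i (cs.isRightDescent_iff_not_isRightDescent_mul.mp hj) (by omega)
      refine ⟨v, k + 1, ?_, by omega, hvi, hvj⟩
      rw [alternatingWord_succ, wordProd_concat, ← mul_assoc, ← hw]
      simp
    · exact ⟨w, 0, by simp [alternatingWord], by omega, hi, hj⟩

/-- The image of `αᵢ` under an alternating word ending with `j`. -/
theorem sin_smul_alternatingWord_apply (cs : CoxeterSystem M W) {α : B → V}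
    {f : B → Module.Dual ℝ V}
    (hf : ∀ i j, f i (α j) = -2 * Real.cos (Real.pi / M i j)) {ρ : W →* (V ≃ₗ[ℝ] V)}
    (hρ : ∀ i v, ρ (cs.simple i) v = v - f i v • α i) (i j : B) (k : ℕ) :
    Real.sin (Real.pi / M i j) • ρ (cs.wordProd (alternatingWord i j k)) (α i) =
      if Even k then Real.sin ((k + 1) * (Real.pi / M i j)) • α i +
          Real.sin (k * (Real.pi / M i j)) • α j
        else Real.sin (k * (Real.pi / M i j)) • α i +
          Real.sin ((k + 1) * (Real.pi / M i j)) • α j := by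
  have hii : ∀ i, f i (α i) = 2 := fun i => by simp [hf]
  have hji : f j (α i) = -2 * Real.cos (Real.pi / M i j) := by rw [hf, M.symmetric]
  induction k with
  | zero => simp [alternatingWord]
  | succ k ih =>
    rw [alternatingWord_succ', wordProd_cons, map_mul, LinearEquiv.mul_apply, ← map_smul, ih]
    push_cast
    rw [Real.sin_add_two_mul]
    by_cases hk : Even k
    · simp only [hk, Nat.even_add_one, if_true, not_true, if_false, hρ, map_add, map_smul, hii, hji]
      module
    · simp only [hk, Nat.even_add_one, if_true, not_false_eq_true, if_false, hρ, map_add, map_smul,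
        hii, hf i j]
      module

/-- **Tits' positivity theorem**: if `ℓ (w sᵢ) > ℓ w`, then `w αᵢ` lies in every convex cone that
contains the simple roots. -/
theorem apply_mem_of_not_isRightDescent (cs : CoxeterSystem M W) (hM : ∀ i j, M i j ≠ 0)
    {α : B → V} {f : B → Module.Dual ℝ V}
    (hf : ∀ i j, f i (α j) = -2 * Real.cos (Real.pi / M i j)) {ρ : W →* (V ≃ₗ[ℝ] V)}
    (hρ : ∀ i v, ρ (cs.simple i) v = v - f i v • α i)
    (K : ConvexCone ℝ V) (h0 : (0 : V) ∈ K) (hK : ∀ i, α i ∈ K) {w : W} {i : B}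
    (hi : ¬ cs.IsRightDescent w i) : ρ w (α i) ∈ K := by
  induction hn : cs.length w using Nat.strong_induction_on generalizing w i with
  | _ n ih =>
  subst hn
  by_cases hw1 : w = 1
  · simpa [hw1] using hK i
  obtain ⟨j, hj⟩ := cs.exists_rightDescent_of_ne_one hw1
  have hij : i ≠ j := fun h => hi (h ▸ hj)
  obtain ⟨v, k, hw, hl, hvi, hvj⟩ := cs.exists_eq_mul_alternatingWord j hi
  have hk0 : k ≠ 0 := by
    rintro rfl
    simp [alternatingWord] at hw
    exact hvj (hw ▸ hj)
  have hred : cs.IsReduced (alternatingWord i j k) := by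
    refine le_antisymm (cs.length_wordProd_le _) ?_
    have := cs.length_mul_le v (cs.wordProd (alternatingWord i j k))
    rw [← hw] at this
    rw [length_alternatingWord]
    omega
  have hkM : k < M i j := by
    refine lt_of_le_of_ne ?_ ?_
    · by_contra hc
      exact cs.not_isReduced_alternatingWord i j (hM i j) (not_le.mp hc) hred
    -- At full length the braid relation rewrites the word so that it ends in `i`; cancelling this
    -- letter would make `i` a right descent of `w`.
    · intro hkM
      apply hi
      have hb := cs.wordProd_braidWord_eq i j
      obtain ⟨p, rfl⟩ := Nat.exists_eq_succ_of_ne_zero hk0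
      rw [braidWord, braidWord, M.symmetric j i, ← hkM, Nat.succ_eq_add_one,
        alternatingWord_succ j i, wordProd_concat] at hb
      have hws : w * cs.simple i = v * cs.wordProd (alternatingWord i j p) := by
        rw [hw, Nat.succ_eq_add_one, hb]
        simp [mul_assoc]
      have h1 := cs.length_mul_le v (cs.wordProd (alternatingWord i j p))
      have h2 := cs.length_wordProd_le (alternatingWord i j p)
      rw [length_alternatingWord] at h2
      rw [IsRightDescent, hws]
      omega
  have hM2 : 2 ≤ M i j := by
    have := M.off_diagonal i j hij
    have := hM i j
    omega
  have hsin := Real.sin_pi_div_pos hM2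
  have hmem : ∀ a : ℝ, 0 ≤ a → ∀ x ∈ K, a • x ∈ K := by
    intro a ha x hx
    rcases ha.eq_or_lt with rfl | ha
    · simpa using h0
    · exact K.smul_mem ha hx
  have hvi' : ρ v (α i) ∈ K := ih _ (by omega) hvi rfl
  have hvj' : ρ v (α j) ∈ K := ih _ (by omega) hvj rfl
  have ha := Real.sin_mul_pi_div_nonneg hkM.le
  have hb := Real.sin_mul_pi_div_nonneg (Nat.succ_le_of_lt hkM)
  push_cast at hb
  -- As `k + 1 ≤ M i j`, both sine coefficients are nonnegative, so `ρ w (α i)` is a nonnegative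
  -- combination of `ρ v (α i)` and `ρ v (α j)`, where `v` is shorter than `w`.
  have key : Real.sin (Real.pi / M i j) • ρ w (α i) ∈ K := by
    rw [hw, map_mul, LinearEquiv.mul_apply, ← map_smul,
      cs.sin_smul_alternatingWord_apply hf hρ]
    split_ifs <;> rw [map_add, map_smul, map_smul] <;>
      exact K.add_mem (hmem _ (by assumption) _ hvi') (hmem _ (by assumption) _ hvj')
  have := hmem _ (inv_nonneg.mpr hsin.le) _ key
  rwa [inv_smul_smul₀ hsin.ne'] at this

end CoxeterSystem

/-! ### Dihedral relations between linear reflections. -/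

namespace Module

open Polynomial.Chebyshev

/-- Two reflections with `f y = g x = -2 cos (π / m)` have a product whose order divides `m`. -/
theorem reflection_mul_reflection_pow_eq_one {V : Type*} [AddCommGroup V] [Module ℝ V] {x y : V}
    {f g : Dual ℝ V} (hf : f x = 2) (hg : g y = 2) {m : ℕ} (hm : 2 ≤ m)
    (hfy : f y = -2 * Real.cos (Real.pi / m)) (hgx : g x = -2 * Real.cos (Real.pi / m)) :
    (reflection hf * reflection hg) ^ m = 1 := by
  -- The case `m = 2` is separate: there `sin (2 * θ) = 0`, and the Chebyshev values below could not
  -- be isolated by cancelling it.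
  rcases hm.eq_or_lt with rfl | hm3
  · have hfy' : f y = 0 := by simp [hfy]
    have hgx' : g x = 0 := by simp [hgx]
    ext z
    simp only [pow_two, LinearEquiv.mul_apply, reflection_apply, map_sub, map_smul, hf, hg, hfy',
      hgx', LinearEquiv.coe_one, id]
    module
  set θ := Real.pi / m with hθ
  have hm0 : (0 : ℝ) < m := by exact_mod_cast (by omega : 0 < m)
  have hmθ : m * θ = Real.pi := by rw [hθ]; field_simp
  have hs : Real.sin (2 * θ) ≠ 0 := by
    have : (2 : ℝ) < m := by exact_mod_cast hm3
    have hθ0 : 0 < θ := by positivity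
    exact (Real.sin_pos_of_pos_of_lt_pi (by positivity) (by nlinarith)).ne'
  have ht : 2 * Real.cos (2 * θ) = f y * g x - 2 := by
    rw [hfy, hgx, Real.cos_two_mul]
    ring
  have hS : ∀ k : ℤ, (S ℝ k).eval (2 * Real.cos (2 * θ)) * Real.sin (2 * θ) =
    Real.sin ((k + 1) * (2 * θ)) := fun k => S_two_mul_real_cos (2 * θ) k
  ext z
  rw [reflection_mul_reflection_pow_apply hf hg m z _ ht]
  -- The correction terms in the formula for the power contain `S (p - 1)` for `m = 2p`, and `S p +
  -- S (p - 1)` for `m = 2p + 1`. These vanish because `sin π = 0` and `sin (π + θ) + sin (π - θ) =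
  -- 0`.
  rcases Nat.even_or_odd' m with ⟨p, hp | hp⟩
  · have e1 : ((m : ℤ) - 2) / 2 = p - 1 := by omega
    have e2 : ((m : ℤ) - 1) / 2 = p - 1 := by omega
    have h0 : (S ℝ ((p : ℤ) - 1)).eval (2 * Real.cos (2 * θ)) = 0 := by
      refine (mul_eq_zero.mp ?_).resolve_right hs
      rw [hS, ← Real.sin_pi, ← hmθ, hp]
      push_cast
      ring_nf
    rw [e1, e2, h0]
    simp
  · have e1 : ((m : ℤ) - 2) / 2 = p - 1 := by omega
    have e2 : ((m : ℤ) - 1) / 2 = p := by omega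
    have e3 : ((m : ℤ) - 3) / 2 = p - 1 := by omega
    have e4 : (m : ℤ) / 2 = p := by omega
    have h0 : (S ℝ (p : ℤ)).eval (2 * Real.cos (2 * θ)) +
        (S ℝ ((p : ℤ) - 1)).eval (2 * Real.cos (2 * θ)) = 0 := by
      refine (mul_eq_zero.mp ?_).resolve_right hs
      have h2 : (((p : ℤ) : ℝ) + 1) * (2 * θ) = Real.pi + θ := by
        rw [← hmθ, hp]; push_cast; ring
      have h3 : ((((p : ℤ) - 1 : ℤ) : ℝ) + 1) * (2 * θ) = Real.pi - θ := by
        rw [← hmθ, hp]; push_cast; ring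
      rw [add_mul, hS, hS, h2, h3, Real.sin_pi_sub, add_comm Real.pi, Real.sin_add_pi]
      ring
    rw [e1, e2, e3, e4, h0]
    simp

end Module

/-! ### Linear forms on the tetrahedron and its face normals. -/

namespace TetrahedronColoring

/-- `form g` as a bilinear form. -/
def formBilin (g : Geometry) : (Fin 4 → ℝ) →ₗ[ℝ] (Fin 4 → ℝ) →ₗ[ℝ] ℝ :=
  LinearMap.mk₂ ℝ (form g) (by intros; simp [form]; ring) (by intros; simp [form]; ring)
    (by intros; simp [form]; ring) (by intros; simp [form]; ring)

theorem form_comm (g : Geometry) (x y : Fin 4 → ℝ) : form g x y = form g y x := by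
  simp only [form]; ring

theorem dotProduct_normalVector (g : Geometry) (l n : Fin 4 → ℝ) :
    l ⬝ᵥ normalVector g n = form g n l := by
  simp [dotProduct, Fin.sum_univ_four, normalVector, form]
  ring

/-- The reflection acts on linear forms by the reflection in the unit normal vector. -/
theorem sub_smul_dotProduct_reflect (g : Geometry) {n : Fin 4 → ℝ} (hn : form g n n = 1)
    (l x : Fin 4 → ℝ) :
    (l - (2 * form g n l) • n) ⬝ᵥ reflect g n x = l ⬝ᵥ x := by
  simp only [reflect, sub_dotProduct, dotProduct_sub, smul_dotProduct, dotProduct_smul,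
    dotProduct_normalVector, hn, smul_eq_mul]
  ring

theorem IsVertex.causal {x : Fin 4 → ℝ} (hx : IsVertex .hyperbolic x) :
    0 < x 0 ∧ form .hyperbolic x x ≤ 0 := by
  rcases hx with ⟨h1, h2⟩ | ⟨h1, h2⟩
  · exact ⟨h2, by linarith⟩
  · exact ⟨h2, h1.le⟩

/-- The vector `x 0 • y - y 0 • x` is nonzero with vanishing time coordinate, so its form is
positive. Expanding that form bounds `2 * x 0 * y 0` times `form x y` strictly above by 0.
Independence excludes two vectors on one ideal ray. -/
theorem form_hyperbolic_neg {x y : Fin 4 → ℝ} (hx : IsVertex .hyperbolic x)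
    (hy : IsVertex .hyperbolic y) (hxy : LinearIndependent ℝ ![x, y]) :
    form .hyperbolic x y < 0 := by
  obtain ⟨x0, hx⟩ := hx.causal
  obtain ⟨y0, hy⟩ := hy.causal
  simp only [form, Geometry.curvature] at *
  have hd : 0 < (x 0 * y 1 - y 0 * x 1) ^ 2 + (x 0 * y 2 - y 0 * x 2) ^ 2 +
      (x 0 * y 3 - y 0 * x 3) ^ 2 := by
    by_contra hc
    have q1 := sq_nonneg (x 0 * y 1 - y 0 * x 1)
    have q2 := sq_nonneg (x 0 * y 2 - y 0 * x 2)
    have q3 := sq_nonneg (x 0 * y 3 - y 0 * x 3)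
    have r1 : x 0 * y 1 - y 0 * x 1 = 0 := pow_eq_zero_iff two_ne_zero |>.mp (by linarith)
    have r2 : x 0 * y 2 - y 0 * x 2 = 0 := pow_eq_zero_iff two_ne_zero |>.mp (by linarith)
    have r3 : x 0 * y 3 - y 0 * x 3 = 0 := pow_eq_zero_iff two_ne_zero |>.mp (by linarith)
    have := LinearIndependent.pair_iff.mp hxy (-(y 0)) (x 0) (by
      ext b
      fin_cases b <;> simp <;> linarith)
    exact x0.ne' this.2
  have a1 := mul_le_mul_of_nonneg_left hx (sq_nonneg (y 0))
  have a2 := mul_le_mul_of_nonneg_left hy (sq_nonneg (x 0))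
  have hp : 0 < x 0 * y 0 := mul_pos x0 y0
  have : (x 0 * y 0) * (-1 * (x 0 * y 0) + x 1 * y 1 + x 2 * y 2 + x 3 * y 3) < 0 := by
    nlinarith
  exact (mul_neg_iff.mp this).elim (fun h => h.2) (fun h => absurd h.1 hp.not_gt)

/-- An ideal vertex is not a point of the space, so forms cannot be tested on vertices directly; a
midpoint of an edge always lies in the space. -/
theorem exists_isPoint_smul_add {g : Geometry} {x y : Fin 4 → ℝ} (hx : IsVertex g x)
    (hy : IsVertex g y) (hxy : LinearIndependent ℝ ![x, y]) :
    ∃ a : ℝ, 0 < a ∧ IsPoint g (a • (x + y)) := by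
  cases g with
  | spherical =>
    have hne : x + y ≠ 0 := fun h => by
      simpa using LinearIndependent.pair_iff.mp hxy 1 1 (by simpa using h)
    have hpos : 0 < form .spherical (x + y) (x + y) := by
      have : form .spherical (x + y) (x + y) = (x + y) ⬝ᵥ (x + y) := by
        simp [form, Geometry.curvature, dotProduct, Fin.sum_univ_four]
      rw [this]
      exact lt_of_le_of_ne (Finset.sum_nonneg fun i _ => mul_self_nonneg _)
        (fun h => hne (dotProduct_self_eq_zero.mp h.symm))
    refine ⟨(Real.sqrt (form .spherical (x + y) (x + y)))⁻¹, by positivity, ?_⟩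
    rw [IsPoint, Tetrahedron.form_smul, inv_pow, Real.sq_sqrt hpos.le, inv_mul_cancel₀ hpos.ne']
  | euclidean =>
    refine ⟨1 / 2, by norm_num, ?_⟩
    simp only [IsVertex, IsPoint] at *
    simp [hx, hy]
    norm_num
  | hyperbolic =>
    have hxy' := form_hyperbolic_neg hx hy hxy
    obtain ⟨x0, hx⟩ := hx.causal
    obtain ⟨y0, hy⟩ := hy.causal
    have hpos : 0 < -form .hyperbolic (x + y) (x + y) := by
      simp only [form, Geometry.curvature, Pi.add_apply] at *
      nlinarith
    refine ⟨(Real.sqrt (-form .hyperbolic (x + y) (x + y)))⁻¹, by positivity, ?_, ?_⟩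
    · rw [Tetrahedron.form_smul, inv_pow, Real.sq_sqrt hpos.le, inv_neg, neg_mul,
        inv_mul_cancel₀ (neg_pos.mp hpos).ne]
    · have : 0 < x 0 + y 0 := by positivity
      simp only [Pi.smul_apply, Pi.add_apply, smul_eq_mul]
      positivity

namespace Tetrahedron

variable {g : Geometry} (t : Tetrahedron g)

/-- A linear form that vanishes on the tetrahedron is zero. -/
theorem eq_zero_of_forall_mem_body {l : Fin 4 → ℝ} (h : ∀ x ∈ t.body, l ⬝ᵥ x.1 = 0) : l = 0 := by
  have hadd : ∀ j k, j ≠ k → l ⬝ᵥ t.vertex j + l ⬝ᵥ t.vertex k = 0 := by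
    intro j k hjk
    have hpair : LinearIndependent ℝ ![t.vertex j, t.vertex k] := by
      have := t.linearIndependent.comp ![j, k] (by
        intro a b hab
        fin_cases a <;> fin_cases b <;> simp_all [eq_comm])
      convert this using 1
      ext a b
      fin_cases a <;> simp
    obtain ⟨a, ha, hp⟩ := exists_isPoint_smul_add (t.isVertex j) (t.isVertex k) hpair
    have := h ⟨_, hp⟩ ⟨fun i => a * (if i = j then 1 else 0) + a * (if i = k then 1 else 0),
      fun i => by positivity, by
        simp [add_smul, Finset.sum_add_distrib]⟩
    rw [dotProduct_smul, dotProduct_add, smul_eq_mul] at this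
    exact (mul_eq_zero.mp this).resolve_left ha.ne'
  -- Values on three vertices with all pairwise sums zero must vanish; edge midpoints therefore
  -- suffice.
  have hv : ∀ j, l ⬝ᵥ t.vertex j = 0 := by
    have h01 := hadd 0 1 (by decide)
    have h02 := hadd 0 2 (by decide)
    have h12 := hadd 1 2 (by decide)
    have h03 := hadd 0 3 (by decide)
    intro j
    fin_cases j <;> simp only [Fin.zero_eta, Fin.mk_one, Fin.reduceFinMk] <;> linarith
  by_contra hl
  have hA : IsUnit (Matrix.of t.vertex) :=
    Matrix.linearIndependent_rows_iff_isUnit.mp t.linearIndependent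
  apply hl
  apply Matrix.mulVec_injective_iff_isUnit.mpr hA
  ext j
  simpa [Matrix.mulVec, dotProduct_comm] using hv j

theorem faceNormal_dotProduct_nonneg (i : Fin 4) {x : Space g} (hx : x ∈ t.body) :
    0 ≤ t.faceNormal i ⬝ᵥ x.1 := by
  obtain ⟨a, ha, hx⟩ := hx
  obtain ⟨-, h0, hi⟩ := t.isFaceNormal_faceNormal i
  rw [hx, dotProduct_sum]
  refine Finset.sum_nonneg fun j _ => ?_
  rw [dotProduct_smul, smul_eq_mul]
  refine mul_nonneg (ha j) ?_
  by_cases hj : j = i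
  · exact hj ▸ hi.le
  · exact (h0 j hj).ge

variable {t} in
-- `Real.arccos` is constant outside $[-1,1]$, with values $0$ and $\pi$ there. Since $0 < \pi/m <
-- \pi$, the argument lies inside and the cosine can be recovered.
theorem IsCoxeter.exists_form_eq (ht : t.IsCoxeter) {i j : Fin 4} (hij : i ≠ j) :
    ∃ m : ℕ, 2 ≤ m ∧ form g (t.faceNormal i) (t.faceNormal j) = -Real.cos (Real.pi / m) := by
  obtain ⟨m, hm, h⟩ := ht i j hij
  refine ⟨m, hm, ?_⟩
  have hm' : (1 : ℝ) < m := by exact_mod_cast hm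
  have hlt : Real.pi / m < Real.pi := div_lt_self Real.pi_pos hm'
  have hpos : 0 < Real.pi / m := by positivity
  rw [dihedralAngle] at h
  rw [← h, Real.cos_arccos, neg_neg]
  · by_contra hc
    rw [Real.arccos_eq_pi.mpr (not_le.mp hc).le] at h
    linarith
  · by_contra hc
    rw [Real.arccos_eq_zero.mpr (not_le.mp hc).le] at h
    linarith

end Tetrahedron

end TetrahedronColoring

/-! ### Triviality of the stabilizer of the tetrahedron. -/

namespace TetrahedronColoring.Tetrahedron

variable {g : Geometry} {t : Tetrahedron g}

theorem IsCoxeter.exists_coxeterMatrix (ht : t.IsCoxeter) :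
    ∃ A : CoxeterMatrix (Fin 4), (∀ i j, A i j ≠ 0) ∧
      ∀ i j, form g (t.faceNormal i) (t.faceNormal j) = -Real.cos (Real.pi / A i j) := by
  choose m hm hform using fun i j (hij : i ≠ j) => ht.exists_form_eq (i := i) (j := j) hij
  -- The exponents chosen for `(i, j)` and `(j, i)` are independent choices; using only those with
  -- `i < j` makes the matrix symmetric.
  let N : Fin 4 → Fin 4 → ℕ := fun i j => if h : i = j then 1 else if h' : i < j then m i j h
    else m j i (Ne.symm h)
  have hN : ∀ i j, i ≠ j → 2 ≤ N i j := by
    intro i j hij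
    simp only [N, hij, dite_false]
    split_ifs <;> exact hm _ _ _
  refine ⟨⟨Matrix.of N, ?_, fun i => by simp [N], fun i j hij => ?_⟩, fun i j => ?_, fun i j => ?_⟩
  · ext i j
    rcases lt_trichotomy i j with h | rfl | h
    · simp [N, h.ne, h.ne', h, h.not_gt]
    · simp [N]
    · simp [N, h.ne, h.ne', h, h.not_gt]
  · have := hN i j hij
    simp only [Matrix.of_apply]
    omega
  · by_cases hij : i = j
    · simp [N, hij]
    · have := hN i j hij
      simp only [Matrix.of_apply]
      omega
  · rcases lt_trichotomy i j with h | rfl | h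
    · simp [N, h.ne, h, hform]
    · simp [N, (t.isFaceNormal_faceNormal i).1]
    · rw [form_comm, hform j i h.ne]
      simp [N, h.ne', h.not_gt]

/-- The group of a Coxeter tetrahedron acts simply on the images of the tetrahedron. -/
theorem IsCoxeter.eq_one_of_smul_body_eq (ht : t.IsCoxeter) {h : Equiv.Perm (Space g)}
    (hh : h ∈ t.tetrahedronGroup) (hb : h • t.body = t.body) : h = 1 := by
  obtain ⟨A, hA0, hA⟩ := ht.exists_coxeterMatrix
  let cs := A.toCoxeterSystem
  let α := t.faceNormal
  let f : Fin 4 → Module.Dual ℝ (Fin 4 → ℝ) := fun i => (2 : ℝ) • formBilin g (α i)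
  have hfv : ∀ i v, f i v = 2 * form g (α i) v := fun i v => rfl
  have hf : ∀ i j, f i (α j) = -2 * Real.cos (Real.pi / A i j) := by
    intro i j
    rw [hfv, hA]
    ring
  have hf2 : ∀ i, f i (α i) = 2 := fun i => by simp [hf]
  have hlift : A.IsLiftable (fun i => Module.reflection (hf2 i)) := by
    intro i j
    by_cases hij : i = j
    · subst hij
      rw [A.diagonal, pow_one]
      ext1 v
      exact Module.involutive_reflection (hf2 i) v
    · have h0 := hA0 i j
      have h1 := A.off_diagonal i j hij
      exact Module.reflection_mul_reflection_pow_eq_one _ _ (by omega) (hf i j)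
        (by rw [hf, A.symmetric])
  let ρ := cs.lift ⟨_, hlift⟩
  have hρ : ∀ i v, ρ (cs.simple i) v = v - f i v • α i := by
    intro i v
    simp only [ρ, cs.lift_apply_simple hlift, Module.reflection_apply]
  -- Existence of some `w` is enough: no homomorphism from $H$ to $W$ is needed.
  have hdual : ∃ w, ∀ l (x : Space g), ρ w l ⬝ᵥ (h x).1 = l ⬝ᵥ x.1 := by
    clear hb
    induction hh using Subgroup.closure_induction with
    | mem s hs =>
      obtain ⟨i, rfl⟩ : ∃ i, s = t.faceReflection i := by
        rcases hs with rfl | rfl | rfl | rfl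
        exacts [⟨0, rfl⟩, ⟨1, rfl⟩, ⟨2, rfl⟩, ⟨3, rfl⟩]
      refine ⟨cs.simple i, fun l x => ?_⟩
      rw [hρ, hfv]
      exact sub_smul_dotProduct_reflect g (t.isFaceNormal_faceNormal i).1 l x.1
    | one => exact ⟨1, fun l x => by simp⟩
    | mul a b _ _ iha ihb =>
      obtain ⟨u, hu⟩ := iha
      obtain ⟨v, hv⟩ := ihb
      refine ⟨u * v, fun l x => ?_⟩
      rw [map_mul, LinearEquiv.mul_apply, Equiv.Perm.mul_apply, hu, hv]
    | inv a _ iha =>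
      obtain ⟨u, hu⟩ := iha
      refine ⟨u⁻¹, fun l x => ?_⟩
      rw [← hu, ← LinearEquiv.mul_apply, ← map_mul]
      simp
  obtain ⟨w, hw⟩ := hdual
  obtain rfl : w = 1 := by
    by_contra hw1
    obtain ⟨i, hi⟩ := cs.exists_rightDescent_of_ne_one hw1
    let K : ConvexCone ℝ (Fin 4 → ℝ) :=
      { carrier := {l | ∀ x ∈ t.body, 0 ≤ l ⬝ᵥ x.1}
        smul_mem' := fun a ha l hl x hx => by
          rw [smul_dotProduct]
          exact mul_nonneg ha.le (hl x hx)
        add_mem' := fun l hl l' hl' x hx => by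
          rw [add_dotProduct]
          exact add_nonneg (hl x hx) (hl' x hx) }
    have hneg : ρ (w * cs.simple i) (α i) ∈ K :=
      cs.apply_mem_of_not_isRightDescent hA0 hf hρ K (fun x _ => by simp)
        (fun j x hx => t.faceNormal_dotProduct_nonneg j hx)
        (cs.isRightDescent_iff_not_isRightDescent_mul.mp hi)
    have hsi : ρ (w * cs.simple i) (α i) = -ρ w (α i) := by
      rw [map_mul, LinearEquiv.mul_apply, hρ, hf2, ← map_neg]
      congr 1
      module
    have hzero : ρ w (α i) = 0 := by
      refine t.eq_zero_of_forall_mem_body fun y hy => le_antisymm ?_ ?_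
      · have := hneg y hy
        rw [hsi, neg_dotProduct] at this
        linarith
      -- Invariance of the body enters here: `y = h x` with `x` in the body, and `ρ w (α i)` at `y`
      -- equals `α i` at `x`.
      · rw [← hb] at hy
        obtain ⟨x, hx, rfl⟩ := hy
        exact (t.faceNormal_dotProduct_nonneg i hx).trans_eq (hw (α i) x).symm
    have := hf2 i
    rw [(ρ w).map_eq_zero_iff.mp hzero] at this
    simp at this
  ext1 x
  apply Subtype.ext
  refine dotProduct_eq _ _ fun l => (dotProduct_comm _ _).trans (Eq.trans ?_ (dotProduct_comm _ _))
  simpa using hw l x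

end TetrahedronColoring.Tetrahedron

/-- The color classes of an equivariant surjection are permuted as the colors are. -/
theorem smul_eq_iff_smul_preimage_singleton {G X C : Type*} [Group G] [MulAction G X]
    [MulAction G C] {f : X → C} (hf : Function.Surjective f) (hG : ∀ (a : G) x, f (a • x) = a • f x)
    (a : G) (c c' : C) : a • c = c' ↔ a • (f ⁻¹' {c}) = f ⁻¹' {c'} := by
  have key : a • (f ⁻¹' {c}) = f ⁻¹' {a • c} := by
    ext x
    simp [Set.mem_smul_set_iff_inv_smul_mem, hG, inv_smul_eq_iff]
  rw [key, Set.preimage_eq_preimage hf, Set.singleton_eq_singleton_iff]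

/-! ### Colorings from cosets, and stabilizers of colors. -/

namespace TetrahedronColoring.Tetrahedron

variable {g : Geometry} {t : Tetrahedron g}

theorem IsCoxeter.smul_body_injective (ht : t.IsCoxeter) (M : Subgroup t.tetrahedronGroup) :
    Function.Injective (fun m : M => m • t.body) := by
  intro a b hab
  have hs : (b⁻¹ * a) • t.body = t.body := by
    rw [mul_smul, inv_smul_eq_iff]
    exact hab
  have h1 := ht.eq_one_of_smul_body_eq (b⁻¹ * a).1.2 hs
  exact (inv_mul_eq_one.mp (Subtype.ext (Subtype.ext h1))).symm

theorem IsCoxeter.existsUnique_coloring (ht : t.IsCoxeter) {M : Subgroup t.tetrahedronGroup}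
    (L : Subgroup M) (n : ℕ) (m : Fin n → M) {C : Type*} [Finite C] (c : Fin n ≃ C)
    (hm : Function.Bijective (fun i => (m i : M ⧸ L))) :
    ∃! f : t.Orbit M → C,
      (∀ i, f ⁻¹' {c i} = t.cosetTiles L (m i)) ∧ t.IsTransitiveColoring M n f := by
  let tile : M → t.Orbit M := fun k => ⟨k • t.body, k, rfl⟩
  have htile : Function.Bijective tile :=
    ⟨fun a b hab => ht.smul_body_injective M (congrArg Subtype.val hab),
      fun ⟨_, k, hk⟩ => ⟨k, Subtype.ext hk⟩⟩
  let e := Equiv.ofBijective tile htile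
  -- Colors are identified with cosets, `c i` with that of `m i`; the coloring becomes the quotient
  -- map $M \to M/L$ read on tiles.
  let d : C ≃ M ⧸ L := c.symm.trans (Equiv.ofBijective _ hm)
  have hd : ∀ i, d (c i) = m i := fun i => by simp [d]
  let f : t.Orbit M → C := fun x => d.symm (e.symm x : M)
  have hft : ∀ k, f (tile k) = d.symm (k : M) := by
    intro k
    have : e.symm (tile k) = k := e.symm_apply_apply k
    simp only [f, this]
  have hfib : ∀ i, f ⁻¹' {c i} = t.cosetTiles L (m i) := by
    intro i
    ext x
    obtain ⟨k, rfl⟩ := htile.2 x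
    rw [Set.mem_preimage, hft, Set.mem_singleton_iff, Equiv.symm_apply_eq, hd, eq_comm,
      QuotientGroup.eq]
    constructor
    · exact fun hk => ⟨_, hk, by simp [tile]⟩
    · rintro ⟨l, hl, hk⟩
      -- Well-definedness of the coloring: a tile determines the group element carrying the
      -- tetrahedron to it, so it cannot come from two cosets.
      obtain rfl : k = m i * l := ht.smul_body_injective M hk
      simpa using hl
  have hsurj : Function.Surjective f := by
    intro b
    obtain ⟨k, hk⟩ := QuotientGroup.mk_surjective (d b)
    exact ⟨tile k, by rw [hft, hk, d.symm_apply_apply]⟩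
  let _ : MulAction M C := d.mulAction M
  have hsmul : ∀ (a : M) b, a • b = d.symm (a • d b) := fun _ _ => rfl
  have hequiv : ∀ (a : M) x, f (a • x) = a • f x := by
    intro a x
    obtain ⟨k, rfl⟩ := htile.2 x
    have : a • tile k = tile (a * k) := Subtype.ext (mul_smul a k t.body).symm
    rw [this, hft, hft, hsmul, d.apply_symm_apply]
    rfl
  refine ⟨f, ⟨hfib, ?_, hsurj, inferInstance,
    smul_eq_iff_smul_preimage_singleton hsurj hequiv, ⟨fun a b => ?_⟩⟩, ?_⟩
  · simpa using (Nat.card_congr c).symm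
  · obtain ⟨k, hk⟩ := MulAction.exists_smul_eq M (d a) (d b)
    exact ⟨k, by rw [hsmul, hk, d.symm_apply_apply]⟩
  · rintro f' ⟨hf', -⟩
    funext x
    obtain ⟨i, hi⟩ := c.surjective (f x)
    have hx : x ∈ f' ⁻¹' {c i} := by
      rw [hf', ← hfib]
      exact hi.symm
    exact hx.trans hi

theorem IsTransitiveColoring.exists_subgroup_index_eq {M : Subgroup t.tetrahedronGroup} {n : ℕ}
    {C : Type*} [Finite C] {f : t.Orbit M → C} (hf : t.IsTransitiveColoring M n f) (c : C) :
    ∃ L : Subgroup M, (∀ m : M, m ∈ L ↔ m • (f ⁻¹' {c}) = f ⁻¹' {c}) ∧ L.index = n := by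
  obtain ⟨hn, -, _, hact, _⟩ := hf
  exact ⟨MulAction.stabilizer M c, fun m => hact m c c,
    (MulAction.index_stabilizer_of_transitive M c).trans hn⟩

end TetrahedronColoring.Tetrahedron

theorem mainTheorem1 (g : TetrahedronColoring.Geometry) (t : TetrahedronColoring.Tetrahedron g)
    (ht : t.IsCoxeter) (M : Subgroup t.tetrahedronGroup) :
    (∀ (L : Subgroup M) (n : ℕ) (m : Fin n → M) (C : Type*) [Finite C] (c : Fin n ≃ C),
      L.index = n → Function.Bijective (fun i => (m i : M ⧸ L)) →
        ∃! f : t.Orbit M → C,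
          (∀ i, f ⁻¹' {c i} = t.cosetTiles L (m i)) ∧ t.IsTransitiveColoring M n f) ∧
    (∀ (n : ℕ) (C : Type*) [Finite C] (f : t.Orbit M → C), t.IsTransitiveColoring M n f →
      ∀ c : C, ∃ L : Subgroup M,
        (∀ m : M, m ∈ L ↔ m • (f ⁻¹' {c}) = f ⁻¹' {c}) ∧ L.index = n) :=
  ⟨fun L n m _ _ c _ hm => ht.existsUnique_coloring L n m c hm,
    fun _ _ _ _ hf c => hf.exists_subgroup_index_eq c⟩
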